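/- Let $K$ be a field, let $n\ge 3$, and let $C_n$ be the cycle graph on the vertex set $\{1,\dots,n\}$. Let $S=K[x_1,\dots,x_n]$ with graded maximal ideal $\mathfrak m=(x_1,\dots,x_n)$, and let $I(C_n)=(x_1x_2,\,x_2x_3,\dots,x_{n-1}x_n,\,x_nx_1)\subset S$ be the edge ideal of $C_n$. Let $\operatorname{depth} S/I(C_n)$ be the maximal length of an $S/I(C_n)$-regular sequence contained in $\mathfrak m$, and say that $C_n$ has maximal depth if $$\operatorname{depth} S/I(C_n)=\min\{\dim S/\mathfrak p:\ \mathfrak p\in\operatorname{Ass}(S/I(C_n))\}.$$ Then $C_n$ has maximal depth if and only if $n\equiv 0 \pmod 3$ or $n\equiv 2\pmod 3$. Moreover, writing $\operatorname{bight} I(C_n)$ for the maximum height of a minimal prime of $I(C_n)$, the equality $\operatorname{depth} S/I(C_n)=n-\operatorname{bight} I(C_n)$ also holds if and only if $n\equiv 0\pmod 3$ or $n\equiv 2\pmod 3$. -/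

import Mathlib

section

variable {R : Type*} [CommRing R]

/-- The depth of `M` with respect to the ideal `m`: the supremum of the lengths of the `M`-regular
sequences contained in `m`. When `R` is a standard graded algebra and `m` is its graded maximal
ideal, this is the usual depth of a nonzero finitely generated graded module `M`. -/
noncomputable def moduleDepth (m : Ideal R) (M : Type*) [AddCommGroup M] [Module R M] : ℕ∞ :=
  ⨆ (rs : List R) (_ : (∀ r ∈ rs, r ∈ m) ∧ RingTheory.Sequence.IsRegular M rs),
    (rs.length : ℕ∞)

/-- `mdepth M`, the minimum of the Krull dimensions `dim R/p`, over the associated primes `p`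
of `M`. -/
noncomputable def moduleMdepth (R : Type*) [CommRing R] (M : Type*) [AddCommGroup M] [Module R M] :
    WithBot ℕ∞ :=
  ⨅ p ∈ associatedPrimes R M, ringKrullDim (R ⧸ p)

/-- `M` has maximal depth (with respect to the maximal ideal `m`) if `depth M = mdepth M`. -/
def HasMaximalDepth (m : Ideal R) (M : Type*) [AddCommGroup M] [Module R M] : Prop :=
  (moduleDepth m M : WithBot ℕ∞) = moduleMdepth R M

/-- The big height of an ideal: the maximum height of its minimal primes. -/
noncomputable def bigHeight (I : Ideal R) : ℕ∞ :=
  ⨆ p ∈ I.minimalPrimes, p.height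

/-- The edge ideal of a graph `G`, generated by the monomials `x_i x_j` with `{i, j}` an edge. -/
noncomputable def edgeIdeal (K : Type*) [Field K] {V : Type*} (G : SimpleGraph V) :
    Ideal (MvPolynomial V K) :=
  Ideal.span {f | ∃ i j, G.Adj i j ∧ f = MvPolynomial.X i * MvPolynomial.X j}

end

/-!
For a simplicial complex `Δ` on the variables, the groups `Ext^i(R, R[Δ])` from the quotient by the
variables to the Stanley–Reisner ring detect depth: by Rees' theorem `depth K[Δ]` is the least `i`
with `Ext^i(K, K[Δ]) ≠ 0`. If `Δ` is covered by two subcomplexes, the exact sequence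
`0 → R[Δ ∪ Γ] → R[Δ] × R[Γ] → R[Δ ∩ Γ] → 0` shifts the first nonvanishing degree of `R[Δ ∩ Γ]` up
by one, as soon as it is higher for `Δ` and `Γ`. It is high for stars: `x_v` is regular on the
Stanley–Reisner ring of the star of `v`, with quotient that of the link of `v`.

The independence complex of a cycle of length `L` is covered by the stars of three consecutive
vertices `u, a, w`. The star of `a` meets the union of the other two in the independence complex of
a cycle of length `L - 3`, while all links are independence complexes of paths. Hence the edge ideal
of the cycle has `depth = ⌊(n + 1) / 3⌋`.

The associated primes of a Stanley–Reisner ideal are generated by the complements of the facets. For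
the cycle the facets are the maximal independent sets; such a set dominates the graph, each of its
vertices covering three, so the smallest one has `⌈n / 3⌉` elements. Finally
`⌊(n + 1) / 3⌋ = ⌈n / 3⌉` exactly when `n ≢ 1 (mod 3)`.
-/

section ExtVanishing

open CategoryTheory Abelian

universe w v u

variable {C : Type u} [Category.{v} C] [Abelian C] [HasExt.{w} C]

/-- The groups `Ext^i(N, M)` vanish for all `i < d`; over a Noetherian ring, for `N = R/m` and `M`
finite with `mM ≠ M`, this says that the depth of `M` with respect to `m` is at least `d`. -/
def ExtVanishesBelow (N M : C) (d : ℕ) : Prop :=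
  ∀ i < d, Subsingleton (Ext N M i)

variable {N M : C} {d : ℕ}

theorem extVanishesBelow_zero (N M : C) : ExtVanishesBelow N M 0 :=
  fun _ hi => absurd hi (Nat.not_lt_zero _)

theorem ExtVanishesBelow.mono {e : ℕ} (h : ExtVanishesBelow N M d) (hed : e ≤ d) :
    ExtVanishesBelow N M e :=
  fun i hi => h i (hi.trans_le hed)

theorem subsingleton_ext_of_iso {M' : C} {i : ℕ} (e : M ≅ M') (h : Subsingleton (Ext N M i)) :
    Subsingleton (Ext N M' i) := by
  refine subsingleton_of_forall_eq 0 fun x => ?_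
  rw [← Ext.comp_mk₀_id x, ← e.inv_hom_id, ← Ext.mk₀_comp_mk₀,
    ← Ext.comp_assoc_of_third_deg_zero, Subsingleton.elim (x.comp (Ext.mk₀ e.inv) _) 0,
    Ext.zero_comp]

theorem ExtVanishesBelow.succ_of_shortExact {S : ShortComplex C} (hS : S.ShortExact)
    (hf : ∀ i ≤ d, ∀ x : Ext N S.X₁ i, x.comp (Ext.mk₀ S.f) (add_zero i) = 0)
    (h₃ : ExtVanishesBelow N S.X₃ d) : ExtVanishesBelow N S.X₁ (d + 1) := by
  rintro (_ | i) hi <;> refine subsingleton_of_forall_eq 0 fun x => ?_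
  · have := hS.mono_f
    refine Ext.postcomp_mk₀_injective_of_mono N S.f ?_
    rw [map_zero]
    exact hf 0 d.zero_le x
  · have := h₃ i (by omega)
    obtain ⟨y, rfl⟩ := Ext.covariant_sequence_exact₁ N hS x (hf _ (by omega) x) rfl
    rw [Subsingleton.elim y 0, Ext.zero_comp]

theorem nontrivial_ext_succ_of_shortExact {S : ShortComplex C} (hS : S.ShortExact)
    (h₂ : Subsingleton (Ext N S.X₂ d)) (h₃ : Nontrivial (Ext N S.X₃ d)) :
    Nontrivial (Ext N S.X₁ (d + 1)) := by
  by_contra h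
  rw [not_nontrivial_iff_subsingleton] at h
  obtain ⟨x, hx⟩ := exists_ne (0 : Ext N S.X₃ d)
  obtain ⟨y, rfl⟩ := Ext.covariant_sequence_exact₃ N hS x rfl (Subsingleton.elim _ _)
  exact hx (by rw [Subsingleton.elim y 0, Ext.zero_comp])

theorem nontrivial_ext_self_zero (hN : ¬ Limits.IsZero N) : Nontrivial (Ext N N 0) := by
  refine ⟨Ext.mk₀ (𝟙 N), 0, ?_⟩
  rwa [Ne, Ext.mk₀_eq_zero_iff, ← Limits.IsZero.iff_id_eq_zero]

end ExtVanishing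

section MayerVietoris

variable {R M : Type*} [Ring R] [AddCommGroup M] [Module R M]

/-- The first map of the exact sequence `0 → M/(p ∩ q) → M/p × M/q → M/(p + q) → 0`. -/
def quotientInfToProd (p q : Submodule R M) : M ⧸ p ⊓ q →ₗ[R] (M ⧸ p) × (M ⧸ q) :=
  (Submodule.factor inf_le_left).prod (Submodule.factor inf_le_right)

/-- The second map of the exact sequence `0 → M/(p ∩ q) → M/p × M/q → M/(p + q) → 0`, the
difference of the two projections. -/
def quotientProdToSup (p q : Submodule R M) : (M ⧸ p) × (M ⧸ q) →ₗ[R] M ⧸ p ⊔ q :=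
  (Submodule.factor le_sup_left).coprod (-Submodule.factor le_sup_right)

theorem quotientInfToProd_injective (p q : Submodule R M) :
    Function.Injective (quotientInfToProd p q) := by
  refine (injective_iff_map_eq_zero _).2 fun x hx => ?_
  obtain ⟨x, rfl⟩ := Submodule.mkQ_surjective _ x
  simpa [quotientInfToProd] using hx

theorem quotientProdToSup_surjective (p q : Submodule R M) :
    Function.Surjective (quotientProdToSup p q) := fun x =>
  let ⟨y, hy⟩ := Submodule.factor_surjective le_sup_left x
  ⟨(y, 0), by simpa [quotientProdToSup] using hy⟩

theorem exact_quotientInfToProd_quotientProdToSup (p q : Submodule R M) :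
    Function.Exact (quotientInfToProd p q) (quotientProdToSup p q) := by
  refine LinearMap.exact_of_comp_eq_zero_of_ker_le_range ?_ ?_
  · ext x
    simp [quotientInfToProd, quotientProdToSup]
  · rintro ⟨x, y⟩ hxy
    obtain ⟨x, rfl⟩ := Submodule.mkQ_surjective _ x
    obtain ⟨y, rfl⟩ := Submodule.mkQ_surjective _ y
    have hsub : x - y ∈ p ⊔ q := by
      simpa [quotientProdToSup, ← sub_eq_add_neg, ← Submodule.Quotient.mk_sub] using hxy
    obtain ⟨a, ha, b, hb, hab⟩ := Submodule.mem_sup.1 hsub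
    refine ⟨Submodule.Quotient.mk (x - a), Prod.ext ?_ ?_⟩
    · simpa [quotientInfToProd] using ha
    · have hxb : x - a = y + b := by rw [sub_eq_iff_eq_add, add_assoc, add_comm b, hab]; abel
      simpa [quotientInfToProd, hxb] using hb

end MayerVietoris

section Modules

open CategoryTheory Abelian
open scoped Pointwise

universe u

variable {R : Type u} [CommRing R] {N M : ModuleCat.{u} R} {d : ℕ}

theorem extVanishesBelow_succ_of_isSMulRegular {r : R} (hr : r ∈ Module.annihilator R N)
    (hreg : IsSMulRegular M r)
    (h : ExtVanishesBelow N (ModuleCat.of R (M ⧸ r • (⊤ : Submodule R M))) d) :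
    ExtVanishesBelow N M (d + 1) := by
  have hzero (i : ℕ) (x : Ext N M i) : x.comp (Ext.mk₀ (r • 𝟙 M)) (add_zero i) = 0 :=
    DFunLike.congr_fun (congrArg AddCommGrpCat.Hom.hom
      (Ext.postcomp_smul_id_eq_zero_of_mem_annihilator hr i)) x
  exact .succ_of_shortExact hreg.smulShortComplex_shortExact (fun i _ x => hzero i x) h

theorem extVanishesBelow_quotient_of_isSMulRegular {I : Ideal R} {r : R}
    (hr : r ∈ Module.annihilator R N) (hreg : IsSMulRegular (R ⧸ I) r)
    (h : ExtVanishesBelow N (ModuleCat.of R (R ⧸ I ⊔ Ideal.span {r})) d) :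
    ExtVanishesBelow N (ModuleCat.of R (R ⧸ I)) (d + 1) := by
  have hmap : Submodule.map I.mkQ (Ideal.span {r}) = r • (⊤ : Submodule R (R ⧸ I)) := by
    rw [← Submodule.range_mkQ I, ← Submodule.map_top, ← Submodule.map_pointwise_smul,
      ← Submodule.ideal_span_singleton_smul, smul_eq_mul, Ideal.mul_top]
  let e : (R ⧸ I ⊔ Ideal.span {r}) ≃ₗ[R] (R ⧸ I) ⧸ r • (⊤ : Submodule R (R ⧸ I)) :=
    (Submodule.quotientQuotientEquivQuotientSup I (Ideal.span {r})).symm ≪≫ₗ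
      Submodule.quotEquivOfEq _ _ hmap
  exact extVanishesBelow_succ_of_isSMulRegular hr hreg
    fun i hi => subsingleton_ext_of_iso e.toModuleIso (h i hi)

/-- The short exact sequence `0 → A/(p ∩ q) → A/p × A/q → A/(p + q) → 0` in `ModuleCat R`. -/
def mayerVietorisComplex {A : Type u} [AddCommGroup A] [Module R A] (p q : Submodule R A) :
    ShortComplex (ModuleCat.{u} R) :=
  ModuleCat.shortComplexOfCompEqZero (quotientInfToProd p q) (quotientProdToSup p q)
    (exact_quotientInfToProd_quotientProdToSup p q).linearMap_comp_eq_zero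

variable {A : Type u} [AddCommGroup A] [Module R A] {p q : Submodule R A}

theorem mayerVietorisComplex_shortExact (p q : Submodule R A) :
    (mayerVietorisComplex p q).ShortExact where
  exact := ModuleCat.shortComplex_exact _ (exact_quotientInfToProd_quotientProdToSup p q)
  mono_f := (ModuleCat.mono_iff_injective _).2 (quotientInfToProd_injective p q)
  epi_g := (ModuleCat.epi_iff_surjective _).2 (quotientProdToSup_surjective p q)

theorem subsingleton_ext_prod {A B : ModuleCat.{u} R} {i : ℕ} (_ : Subsingleton (Ext N A i))
    (_ : Subsingleton (Ext N B i)) : Subsingleton (Ext N (ModuleCat.of R (A × B)) i) :=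
  subsingleton_ext_of_iso (ModuleCat.biprodIsoProd A B) Ext.addEquivBiprod.subsingleton

theorem extVanishesBelow_quotient_inf (hp : ExtVanishesBelow N (ModuleCat.of R (A ⧸ p)) (d + 1))
    (hq : ExtVanishesBelow N (ModuleCat.of R (A ⧸ q)) (d + 1))
    (hpq : ExtVanishesBelow N (ModuleCat.of R (A ⧸ p ⊔ q)) d) :
    ExtVanishesBelow N (ModuleCat.of R (A ⧸ p ⊓ q)) (d + 1) :=
  .succ_of_shortExact (mayerVietorisComplex_shortExact p q) (fun i hi _ =>
    (subsingleton_ext_prod (hp i (by omega)) (hq i (by omega))).elim _ _) hpq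

theorem nontrivial_ext_quotient_inf (hp : Subsingleton (Ext N (ModuleCat.of R (A ⧸ p)) d))
    (hq : Subsingleton (Ext N (ModuleCat.of R (A ⧸ q)) d))
    (hpq : Nontrivial (Ext N (ModuleCat.of R (A ⧸ p ⊔ q)) d)) :
    Nontrivial (Ext N (ModuleCat.of R (A ⧸ p ⊓ q)) (d + 1)) :=
  nontrivial_ext_succ_of_shortExact (mayerVietorisComplex_shortExact p q)
    (subsingleton_ext_prod hp hq) hpq

theorem smul_top_quotient_lt_top {S : Type*} [CommRing S] {I m : Ideal S} (hI : I ≤ m)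
    (hm : m ≠ ⊤) : m • (⊤ : Submodule S (S ⧸ I)) < ⊤ := by
  rw [lt_top_iff_ne_top, Ideal.smul_top_eq_map, Ne, Submodule.restrictScalars_eq_top_iff]
  exact fun h => hm (by rw [← Ideal.comap_map_mk hI]; exact Ideal.comap_eq_top_iff.2 h)

theorem moduleDepth_eq_of_ext [IsNoetherianRing R] {m : Ideal R} [Module.Finite R M]
    (hm : m • (⊤ : Submodule R M) < ⊤) (hd : ExtVanishesBelow (ModuleCat.of R (R ⧸ m)) M d)
    (hne : Nontrivial (Ext (ModuleCat.of R (R ⧸ m)) M d)) : moduleDepth m M = d := by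
  have hsupp : Module.support R (ModuleCat.of R (R ⧸ m)) = PrimeSpectrum.zeroLocus m :=
    Module.support_eq_zeroLocus.trans (by rw [Ideal.annihilator_quotient])
  apply le_antisymm
  · refine iSup₂_le fun rs hrs => Nat.cast_le.2 (not_lt.1 fun hlt => ?_)
    exact not_subsingleton_iff_nontrivial.2 hne <|
      ModuleCat.subsingleton_ext_of_exists_isRegular m _ hsupp.subset M hm rs hrs.1 hrs.2 d hlt
  · obtain ⟨rs, rfl, hrs⟩ :=
      ModuleCat.exists_isRegular_of_exists_subsingleton_ext m d M hm _ hsupp hd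
    exact le_iSup₂_of_le rs hrs le_rfl

end Modules

section StanleyReisner

open CategoryTheory Abelian MvPolynomial

universe u v

variable {V : Type v} {Δ Γ : LowerSet (Finset V)}

section Ideals

variable (R : Type u) [CommRing R]

/-- The Stanley–Reisner ideal of a simplicial complex, spanned by the monomials whose support is
not a face. A complex is encoded as the lower set of its faces: a vertex need not be a face, and the
void complex, without even the face `∅`, is allowed. -/
noncomputable def stanleyReisnerIdeal (Δ : LowerSet (Finset V)) : Ideal (MvPolynomial V R) :=
  Ideal.span ((fun s => monomial s (1 : R)) '' {m | m.support ∉ Δ})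

variable {R}

theorem mem_stanleyReisnerIdeal {f : MvPolynomial V R} :
    f ∈ stanleyReisnerIdeal R Δ ↔ ∀ m ∈ f.support, m.support ∉ Δ := by
  rw [stanleyReisnerIdeal, mem_ideal_span_monomial_image]
  refine forall₂_congr fun m _ => ⟨?_, fun h => ⟨m, h, le_rfl⟩⟩
  rintro ⟨s, hs, hsm⟩ hm
  exact hs (Δ.lower (Finsupp.support_mono hsm) hm)

theorem monomial_mem_stanleyReisnerIdeal {m : V →₀ ℕ} (hm : m.support ∉ Δ) :
    monomial m (1 : R) ∈ stanleyReisnerIdeal R Δ :=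
  Ideal.subset_span ⟨m, hm, rfl⟩

theorem stanleyReisnerIdeal_le {J : Ideal (MvPolynomial V R)} :
    stanleyReisnerIdeal R Δ ≤ J ↔ ∀ m : V →₀ ℕ, m.support ∉ Δ → monomial m (1 : R) ∈ J := by
  simp [stanleyReisnerIdeal, Ideal.span_le, Set.subset_def]

theorem stanleyReisnerIdeal_anti (h : Δ ≤ Γ) : stanleyReisnerIdeal R Γ ≤ stanleyReisnerIdeal R Δ :=
  stanleyReisnerIdeal_le.2 fun _ hm => monomial_mem_stanleyReisnerIdeal fun hm' => hm (h hm')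

theorem stanleyReisnerIdeal_sup (Δ Γ : LowerSet (Finset V)) :
    stanleyReisnerIdeal R (Δ ⊔ Γ) = stanleyReisnerIdeal R Δ ⊓ stanleyReisnerIdeal R Γ := by
  ext f
  simp only [Ideal.mem_inf, mem_stanleyReisnerIdeal, LowerSet.mem_sup_iff, not_or, forall_and]

theorem stanleyReisnerIdeal_inf (Δ Γ : LowerSet (Finset V)) :
    stanleyReisnerIdeal R (Δ ⊓ Γ) = stanleyReisnerIdeal R Δ ⊔ stanleyReisnerIdeal R Γ := by
  refine le_antisymm (stanleyReisnerIdeal_le.2 fun m hm => ?_)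
    (sup_le (stanleyReisnerIdeal_anti inf_le_left) (stanleyReisnerIdeal_anti inf_le_right))
  rcases not_and_or.1 hm with hΔ | hΓ
  · exact Ideal.mem_sup_left (monomial_mem_stanleyReisnerIdeal hΔ)
  · exact Ideal.mem_sup_right (monomial_mem_stanleyReisnerIdeal hΓ)

theorem mem_idealOfVars {f : MvPolynomial V R} :
    f ∈ idealOfVars V R ↔ ∀ m ∈ f.support, m ≠ 0 := by
  rw [idealOfVars, ← Set.image_univ, mem_ideal_span_X_image]
  simp [Finsupp.ext_iff]

theorem idealOfVars_ne_top [Nontrivial R] : idealOfVars V R ≠ ⊤ := by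
  rw [Ne, Ideal.eq_top_iff_one, mem_idealOfVars]
  exact fun h => h 0 (by simp) rfl

theorem stanleyReisnerIdeal_Iic_empty :
    stanleyReisnerIdeal R (LowerSet.Iic (∅ : Finset V)) = idealOfVars V R := by
  ext f
  simp [mem_stanleyReisnerIdeal, mem_idealOfVars]

theorem stanleyReisnerIdeal_le_idealOfVars (h : ∅ ∈ Δ) :
    stanleyReisnerIdeal R Δ ≤ idealOfVars V R := by
  rw [← stanleyReisnerIdeal_Iic_empty]
  exact stanleyReisnerIdeal_anti (LowerSet.Iic_le.2 h)

end Ideals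

section Complexes

variable [DecidableEq V]

/-- The star of the vertex `v` in `Δ`: the faces `F` such that `F ∪ {v}` is a face. It is the void
complex if `{v}` is not a face. -/
def starComplex (v : V) (Δ : LowerSet (Finset V)) : LowerSet (Finset V) where
  carrier := {F | insert v F ∈ Δ}
  lower' _ _ hFG hF := Δ.lower (Finset.insert_subset_insert v hFG) hF

/-- The link of the vertex `v` in `Δ`: the faces of the star of `v` which do not contain `v`. -/
def linkComplex (v : V) (Δ : LowerSet (Finset V)) : LowerSet (Finset V) where
  carrier := {F | v ∉ F ∧ insert v F ∈ Δ}
  lower' _ _ hFG hF := ⟨fun hv => hF.1 (hFG hv), (starComplex v Δ).lower hFG hF.2⟩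

variable {v w : V} {F : Finset V}

theorem mem_starComplex : F ∈ starComplex v Δ ↔ insert v F ∈ Δ := Iff.rfl

theorem mem_linkComplex : F ∈ linkComplex v Δ ↔ v ∉ F ∧ insert v F ∈ Δ := Iff.rfl

theorem starComplex_le : starComplex v Δ ≤ Δ :=
  fun F hF => Δ.lower (Finset.subset_insert v F) hF

theorem linkComplex_le_starComplex : linkComplex v Δ ≤ starComplex v Δ :=
  fun _ hF => hF.2

theorem linkComplex_starComplex_comm (h : v ≠ w) :
    linkComplex w (starComplex v Δ) = starComplex v (linkComplex w Δ) := by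
  ext F
  simp [mem_starComplex, mem_linkComplex, Finset.insert_comm v w F, h.symm]

variable {R : Type u} [CommRing R]

theorem isSMulRegular_X_quotient_starComplex (v : V) (Δ : LowerSet (Finset V)) :
    IsSMulRegular (MvPolynomial V R ⧸ stanleyReisnerIdeal R (starComplex v Δ))
      (X v : MvPolynomial V R) := by
  refine isSMulRegular_iff_right_eq_zero_of_smul.2 fun f hf => ?_
  obtain ⟨f, rfl⟩ := Submodule.Quotient.mk_surjective _ f
  rw [← Submodule.Quotient.mk_smul, Submodule.Quotient.mk_eq_zero, smul_eq_mul,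
    mem_stanleyReisnerIdeal] at hf
  rw [Submodule.Quotient.mk_eq_zero, mem_stanleyReisnerIdeal]
  intro m hm hmem
  refine hf (Finsupp.single v 1 + m) (by simpa [coeff_X_mul] using hm) ?_
  rw [mem_starComplex] at hmem ⊢
  convert hmem using 1
  ext i
  by_cases hi : i = v <;> simp [hi]

theorem stanleyReisnerIdeal_linkComplex (v : V) (Δ : LowerSet (Finset V)) :
    stanleyReisnerIdeal R (linkComplex v Δ) =
      stanleyReisnerIdeal R (starComplex v Δ) ⊔ Ideal.span {X v} := by
  refine le_antisymm (stanleyReisnerIdeal_le.2 fun m hm => ?_)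
    (sup_le (stanleyReisnerIdeal_anti linkComplex_le_starComplex) ?_)
  · by_cases hv : v ∈ m.support
    · refine Ideal.mem_sup_right (Ideal.mem_span_singleton.2 (X_dvd_monomial.2 (Or.inr ?_)))
      exact Finsupp.mem_support_iff.1 hv
    · exact Ideal.mem_sup_left (monomial_mem_stanleyReisnerIdeal fun h => hm ⟨hv, h⟩)
  · rw [Ideal.span_singleton_le_iff_mem]
    exact monomial_mem_stanleyReisnerIdeal fun h => h.1 (by simp)

end Complexes

section Ext

variable (R : Type u) [CommRing R]

/-- The groups `Ext^i(R, R[Δ])` vanish for all `i < d`, where `R[Δ]` is the Stanley–Reisner ring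
of the complex `Δ` and the variables act on `R` by zero. -/
def FaceExtVanishesBelow (Δ : LowerSet (Finset V)) (d : ℕ) : Prop :=
  ExtVanishesBelow (ModuleCat.of (MvPolynomial V R) (MvPolynomial V R ⧸ idealOfVars V R))
    (ModuleCat.of _ (MvPolynomial V R ⧸ stanleyReisnerIdeal R Δ)) d

/-- The smallest `i` with `Ext^i(R, R[Δ]) ≠ 0` is `d`. Over a field, this says that `R[Δ]` has
depth `d`. -/
structure HasFaceDepth (Δ : LowerSet (Finset V)) (d : ℕ) : Prop where
  vanishesBelow : FaceExtVanishesBelow R Δ d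
  nontrivial : Nontrivial
    (Ext (ModuleCat.of (MvPolynomial V R) (MvPolynomial V R ⧸ idealOfVars V R))
      (ModuleCat.of _ (MvPolynomial V R ⧸ stanleyReisnerIdeal R Δ)) d)

variable {R} {d : ℕ}

theorem FaceExtVanishesBelow.zero (Δ : LowerSet (Finset V)) : FaceExtVanishesBelow R Δ 0 :=
  extVanishesBelow_zero _ _

theorem FaceExtVanishesBelow.mono {e : ℕ} (h : FaceExtVanishesBelow R Δ d) (hed : e ≤ d) :
    FaceExtVanishesBelow R Δ e :=
  ExtVanishesBelow.mono h hed

theorem FaceExtVanishesBelow.sup (hΔ : FaceExtVanishesBelow R Δ (d + 1))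
    (hΓ : FaceExtVanishesBelow R Γ (d + 1)) (h : FaceExtVanishesBelow R (Δ ⊓ Γ) d) :
    FaceExtVanishesBelow R (Δ ⊔ Γ) (d + 1) := by
  unfold FaceExtVanishesBelow at *
  rw [stanleyReisnerIdeal_inf] at h
  rw [stanleyReisnerIdeal_sup]
  exact extVanishesBelow_quotient_inf hΔ hΓ h

theorem HasFaceDepth.sup (hΔ : FaceExtVanishesBelow R Δ (d + 1))
    (hΓ : FaceExtVanishesBelow R Γ (d + 1)) (h : HasFaceDepth R (Δ ⊓ Γ) d) :
    HasFaceDepth R (Δ ⊔ Γ) (d + 1) where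
  vanishesBelow := hΔ.sup hΓ h.vanishesBelow
  nontrivial := by
    have hne := h.nontrivial
    rw [stanleyReisnerIdeal_inf] at hne
    rw [stanleyReisnerIdeal_sup]
    exact nontrivial_ext_quotient_inf (hΔ d d.lt_succ_self) (hΓ d d.lt_succ_self) hne

theorem FaceExtVanishesBelow.star [DecidableEq V] {v : V}
    (h : FaceExtVanishesBelow R (linkComplex v Δ) d) :
    FaceExtVanishesBelow R (starComplex v Δ) (d + 1) := by
  unfold FaceExtVanishesBelow at *
  rw [stanleyReisnerIdeal_linkComplex] at h
  refine extVanishesBelow_quotient_of_isSMulRegular ?_ (isSMulRegular_X_quotient_starComplex v Δ) h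
  exact (Ideal.annihilator_quotient (I := idealOfVars V R)).symm ▸ Ideal.subset_span ⟨v, rfl⟩

theorem hasFaceDepth_Iic_empty [Nontrivial R] :
    HasFaceDepth R (LowerSet.Iic (∅ : Finset V)) 0 where
  vanishesBelow := .zero _
  nontrivial := by
    rw [stanleyReisnerIdeal_Iic_empty]
    refine nontrivial_ext_self_zero fun h => idealOfVars_ne_top (R := R) (V := V) ?_
    exact Ideal.Quotient.subsingleton_iff.1 (ModuleCat.subsingleton_of_isZero h)

theorem moduleDepth_stanleyReisner [IsNoetherianRing R] [Nontrivial R] [Finite V] (hΔ : ∅ ∈ Δ)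
    (h : HasFaceDepth R Δ d) :
    moduleDepth (idealOfVars V R) (MvPolynomial V R ⧸ stanleyReisnerIdeal R Δ) = d :=
  moduleDepth_eq_of_ext (M := ModuleCat.of _ (MvPolynomial V R ⧸ stanleyReisnerIdeal R Δ))
    (smul_top_quotient_lt_top (stanleyReisnerIdeal_le_idealOfVars hΔ) idealOfVars_ne_top)
    h.vanishesBelow h.nontrivial

end Ext

end StanleyReisner

section PathsAndCycles

variable {V : Type*} {F : Finset V} {a b u w x : V} {l m : List V}

/-- No two consecutive entries of the list `l` lie in `F`. -/
def NoTwoConsecutive (F : Finset V) (l : List V) : Prop :=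
  l.IsChain fun i j => ¬ (i ∈ F ∧ j ∈ F)

theorem noTwoConsecutive_cons :
    NoTwoConsecutive F (a :: l) ↔ (a ∈ F → ∀ x ∈ l.head?, x ∉ F) ∧ NoTwoConsecutive F l := by
  simp only [NoTwoConsecutive, List.isChain_cons, not_and]
  tauto

theorem noTwoConsecutive_concat :
    NoTwoConsecutive F (l ++ [a]) ↔ NoTwoConsecutive F l ∧ (a ∈ F → ∀ x ∈ l.getLast?, x ∉ F) := by
  grind [NoTwoConsecutive, List.isChain_append, Option.mem_def]

theorem noTwoConsecutive_reverse :
    NoTwoConsecutive F l.reverse ↔ NoTwoConsecutive F l := by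
  simp only [NoTwoConsecutive, List.isChain_reverse, and_comm]

theorem noTwoConsecutive_insert [DecidableEq V] (ha : a ∉ l) :
    NoTwoConsecutive (insert a F) l ↔ NoTwoConsecutive F l :=
  List.IsChain.iff_of_mem_imp fun i j hi hj => by
    simp [ne_of_mem_of_not_mem hi ha, ne_of_mem_of_not_mem hj ha]

/-- The independence complex of a path, given by the list of its vertices. -/
def pathComplex (l : List V) : LowerSet (Finset V) where
  carrier := {F | (∀ i ∈ F, i ∈ l) ∧ NoTwoConsecutive F l}
  lower' _ _ hGF hF :=
    ⟨fun i hi => hF.1 i (hGF hi), hF.2.imp fun _ _ h h' => h ⟨hGF h'.1, hGF h'.2⟩⟩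

/-- The independence complex of a cycle, given by the cyclic list of its vertices. A cycle with a
single vertex is a loop, so that its only face is `∅`. -/
def cycleComplex (c : Cycle V) : LowerSet (Finset V) where
  carrier := {F | (∀ i ∈ F, i ∈ c) ∧ c.Chain fun i j => ¬ (i ∈ F ∧ j ∈ F)}
  lower' _ _ hGF hF :=
    ⟨fun i hi => hF.1 i (hGF hi), hF.2.imp fun _ _ h h' => h ⟨hGF h'.1, hGF h'.2⟩⟩

theorem mem_pathComplex : F ∈ pathComplex l ↔ (∀ i ∈ F, i ∈ l) ∧ NoTwoConsecutive F l := Iff.rfl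

theorem mem_cycleComplex_cons : F ∈ cycleComplex (a :: l : List V) ↔
    (∀ i ∈ F, i ∈ a :: l) ∧ NoTwoConsecutive F (a :: (l ++ [a])) := by
  rw [NoTwoConsecutive, ← Cycle.chain_coe_cons]; rfl

theorem mem_cycleComplex_cons_cons_concat : F ∈ cycleComplex (a :: u :: (l ++ [w]) : List V) ↔
    (∀ i ∈ F, i ∈ a :: u :: (l ++ [w])) ∧ NoTwoConsecutive F l ∧ (a ∈ F → u ∉ F ∧ w ∉ F) ∧
      (u ∈ F → ∀ x ∈ l.head?, x ∉ F) ∧ (w ∈ F → ∀ x ∈ l.getLast?, x ∉ F) ∧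
      (l = [] → u ∈ F → w ∉ F) := by
  rw [mem_cycleComplex_cons, List.cons_append, noTwoConsecutive_cons, noTwoConsecutive_cons,
    noTwoConsecutive_concat, noTwoConsecutive_concat, List.getLast?_concat]
  cases l <;> grind

theorem pathComplex_nil : pathComplex ([] : List V) = LowerSet.Iic ∅ := by
  ext F
  simp [mem_pathComplex, NoTwoConsecutive, Finset.eq_empty_iff_forall_notMem]

theorem pathComplex_reverse (l : List V) : pathComplex l.reverse = pathComplex l := by
  ext F
  simp [mem_pathComplex, noTwoConsecutive_reverse]

theorem cycleComplex_cons_reverse (a : V) (l : List V) :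
    cycleComplex ((a :: l.reverse : List V) : Cycle V) = cycleComplex (a :: l : List V) := by
  refine SetLike.ext fun F => ?_
  rw [mem_cycleComplex_cons, mem_cycleComplex_cons, ← noTwoConsecutive_reverse]
  simp

theorem mem_pathComplex_tail (hl : l.Nodup) :
    F ∈ pathComplex l.tail ↔ F ∈ pathComplex l ∧ ∀ x ∈ l.head?, x ∉ F := by
  cases l with
  | nil => simp
  | cons a l =>
    grind [mem_pathComplex, noTwoConsecutive_cons, Option.mem_def]

theorem mem_pathComplex_dropLast (hl : l.Nodup) :
    F ∈ pathComplex l.dropLast ↔ F ∈ pathComplex l ∧ ∀ x ∈ l.getLast?, x ∉ F := by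
  rw [← pathComplex_reverse, ← pathComplex_reverse l, ← List.tail_reverse, ← List.head?_reverse]
  exact mem_pathComplex_tail (List.nodup_reverse.2 hl)

theorem cycleComplex_coe (hl : l.Nodup) :
    cycleComplex l = pathComplex l.tail ⊔ pathComplex l.dropLast := by
  refine SetLike.ext fun F => ?_
  rw [LowerSet.mem_sup_iff, mem_pathComplex_tail hl, mem_pathComplex_dropLast hl]
  cases l with
  | nil => simp [mem_pathComplex, NoTwoConsecutive, cycleComplex]
  | cons a l =>
    rw [mem_cycleComplex_cons, ← List.cons_append, noTwoConsecutive_concat, mem_pathComplex]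
    grind

section Stars

variable [DecidableEq V]

theorem linkComplex_pathComplex_cons (h : (a :: l).Nodup) :
    linkComplex a (pathComplex (a :: l)) = pathComplex l.tail := by
  refine SetLike.ext fun F => ?_
  rw [mem_linkComplex, mem_pathComplex, noTwoConsecutive_cons,
    noTwoConsecutive_insert (List.nodup_cons.1 h).1, mem_pathComplex_tail h.of_cons,
    mem_pathComplex]
  cases l <;> grind

theorem linkComplex_pathComplex_cons_cons (h : (a :: b :: l).Nodup) :
    linkComplex b (pathComplex (a :: b :: l)) = pathComplex l.tail := by
  refine SetLike.ext fun F => ?_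
  rw [mem_linkComplex, mem_pathComplex, noTwoConsecutive_cons, noTwoConsecutive_cons,
    noTwoConsecutive_insert (List.nodup_cons.1 h.of_cons).1, mem_pathComplex_tail h.of_cons.of_cons,
    mem_pathComplex]
  cases l <;> grind

theorem starComplex_sup_starComplex_pathComplex (h : a ∉ b :: l) :
    starComplex a (pathComplex (a :: b :: l)) ⊔ starComplex b (pathComplex (a :: b :: l)) =
      pathComplex (a :: b :: l) := by
  refine le_antisymm (sup_le starComplex_le starComplex_le) fun F (hF : F ∈ _) => ?_
  simp only [SetLike.mem_coe, LowerSet.mem_sup_iff, mem_starComplex]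
  by_cases hb : b ∈ F
  · rw [Finset.insert_eq_of_mem hb]
    exact Or.inr hF
  · left
    have := noTwoConsecutive_insert (F := F) (List.not_mem_of_not_mem_cons h)
    grind [mem_pathComplex, noTwoConsecutive_cons, Option.mem_def, SetLike.mem_coe]

theorem starComplex_inf_starComplex_pathComplex (h : (a :: b :: l).Nodup) :
    starComplex a (pathComplex (a :: b :: l)) ⊓ starComplex b (pathComplex (a :: b :: l)) =
      pathComplex l.tail := by
  refine SetLike.ext fun F => ?_
  have ha := noTwoConsecutive_insert (F := F) (a := a) (l := l) (by grind)
  have hb := noTwoConsecutive_insert (F := F) (List.nodup_cons.1 h.of_cons).1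
  rw [LowerSet.mem_inf_iff, mem_pathComplex_tail h.of_cons.of_cons, mem_starComplex,
    mem_starComplex, mem_pathComplex, mem_pathComplex, mem_pathComplex]
  simp only [noTwoConsecutive_cons, ha, hb, List.head?_cons, Option.mem_some, forall_eq',
    Finset.mem_insert]
  cases l <;> grind [Option.mem_def]

theorem linkComplex_cycleComplex_cons (h : (a :: l).Nodup) (hl : l ≠ []) :
    linkComplex a (cycleComplex (a :: l : List V)) = pathComplex l.tail.dropLast := by
  refine SetLike.ext fun F => ?_
  have ha := noTwoConsecutive_insert (F := F) (List.nodup_cons.1 h).1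
  rw [mem_pathComplex_dropLast h.of_cons.tail, mem_pathComplex_tail h.of_cons, mem_linkComplex,
    mem_cycleComplex_cons, mem_pathComplex, noTwoConsecutive_cons, noTwoConsecutive_concat, ha]
  obtain ⟨b, l, rfl⟩ := List.exists_cons_of_ne_nil hl
  simp only [List.head?_cons, List.cons_append, Option.mem_some, forall_eq', List.tail_cons,
    Finset.forall_mem_insert]
  obtain rfl | ⟨m, w, rfl⟩ := List.eq_nil_or_concat l <;> grind [Option.mem_def]

theorem starComplex_sup_starComplex_sup_starComplex_cycleComplex (h : a ∉ u :: (l ++ [w])) :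
    starComplex a (cycleComplex (a :: u :: (l ++ [w]) : List V)) ⊔
      (starComplex u (cycleComplex (a :: u :: (l ++ [w]) : List V)) ⊔
        starComplex w (cycleComplex (a :: u :: (l ++ [w]) : List V))) =
      cycleComplex (a :: u :: (l ++ [w]) : List V) := by
  refine le_antisymm (sup_le starComplex_le (sup_le starComplex_le starComplex_le))
    fun F (hF : F ∈ _) => ?_
  simp only [SetLike.mem_coe, LowerSet.mem_sup_iff, mem_starComplex]
  by_cases hu : u ∈ F
  · rw [Finset.insert_eq_of_mem hu]
    exact Or.inr (Or.inl hF)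
  by_cases hw : w ∈ F
  · rw [Finset.insert_eq_of_mem hw]
    exact Or.inr (Or.inr hF)
  left
  have := noTwoConsecutive_insert (F := F) (List.not_mem_of_not_mem_cons h)
  rw [SetLike.mem_coe, mem_cycleComplex_cons, List.cons_append, noTwoConsecutive_cons,
    noTwoConsecutive_cons, noTwoConsecutive_concat] at hF
  rw [mem_cycleComplex_cons, List.cons_append, noTwoConsecutive_cons,
    noTwoConsecutive_cons, noTwoConsecutive_concat]
  grind

theorem starComplex_inf_starComplex_cycleComplex (h : (a :: u :: (l ++ [w])).Nodup) :
    starComplex a (cycleComplex (a :: u :: (l ++ [w]) : List V)) ⊓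
      starComplex u (cycleComplex (a :: u :: (l ++ [w]) : List V)) = pathComplex l.tail := by
  refine SetLike.ext fun F => ?_
  have hl : l.Nodup := by grind
  have ha := noTwoConsecutive_insert (F := F) (a := a) (l := l)
  have hu := noTwoConsecutive_insert (F := F) (a := u) (l := l)
  rw [LowerSet.mem_inf_iff, mem_pathComplex_tail hl]
  simp only [mem_starComplex, mem_cycleComplex_cons_cons_concat, mem_pathComplex,
    Finset.forall_mem_insert]
  grind [Option.mem_def]

theorem starComplex_inf_starComplex_cycleComplex_last (h : (a :: u :: (l ++ [w])).Nodup) :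
    starComplex a (cycleComplex (a :: u :: (l ++ [w]) : List V)) ⊓
      starComplex w (cycleComplex (a :: u :: (l ++ [w]) : List V)) = pathComplex l.dropLast := by
  have hrev : cycleComplex (a :: u :: (l ++ [w]) : List V) =
      cycleComplex ((a :: w :: (l.reverse ++ [u]) : List V) : Cycle V) := by
    rw [← cycleComplex_cons_reverse]
    simp
  rw [hrev, starComplex_inf_starComplex_cycleComplex, List.tail_reverse, pathComplex_reverse]
  grind [List.nodup_append]

theorem starComplex_inf_starComplex_cycleComplex_of_ne_nil (h : (a :: u :: (l ++ [w])).Nodup)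
    (hl : l ≠ []) :
    starComplex u (cycleComplex (a :: u :: (l ++ [w]) : List V)) ⊓
      starComplex w (cycleComplex (a :: u :: (l ++ [w]) : List V)) =
      starComplex u (starComplex w (cycleComplex (a :: u :: (l ++ [w]) : List V))) := by
  refine SetLike.ext fun F => ?_
  have hu := noTwoConsecutive_insert (F := F) (a := u) (l := l)
  have hw := noTwoConsecutive_insert (F := F) (a := w) (l := l)
  have huw := noTwoConsecutive_insert (F := insert u F) (a := w) (l := l)
  rw [LowerSet.mem_inf_iff]
  simp only [mem_starComplex, mem_cycleComplex_cons_cons_concat]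
  grind

theorem linkComplex_pathComplex_concat (h : (l ++ [w]).Nodup) :
    linkComplex w (pathComplex (l ++ [w])) = pathComplex l.dropLast := by
  rw [← pathComplex_reverse, List.reverse_append, ← pathComplex_reverse l.dropLast,
    ← List.tail_reverse]
  exact linkComplex_pathComplex_cons (by simpa using List.nodup_reverse.2 h)

theorem linkComplex_cycleComplex_append (h : (l ++ a :: m).Nodup) (hne : m ++ l ≠ []) :
    linkComplex a (cycleComplex (l ++ a :: m : List V)) =
      pathComplex (m ++ l).tail.dropLast := by
  rw [Cycle.coe_eq_coe.2 List.isRotated_append]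
  exact linkComplex_cycleComplex_cons ((List.isRotated_append (l := l)).nodup_iff.1 h) hne

theorem starComplex_inf_sup_cycleComplex (h : (a :: u :: (l ++ [w])).Nodup) :
    starComplex a (cycleComplex (a :: u :: (l ++ [w]) : List V)) ⊓
      (starComplex u (cycleComplex (a :: u :: (l ++ [w]) : List V)) ⊔
        starComplex w (cycleComplex (a :: u :: (l ++ [w]) : List V))) = cycleComplex l := by
  rw [inf_sup_left, starComplex_inf_starComplex_cycleComplex h,
    starComplex_inf_starComplex_cycleComplex_last h, cycleComplex_coe]
  exact h.of_cons.of_cons.of_append_left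

end Stars

variable {R : Type*} [CommRing R] {d : ℕ}

theorem faceExtVanishesBelow_pathComplex (d : ℕ) (l : List V) (hl : l.Nodup)
    (hd : 3 * d ≤ l.length + 2) :
    FaceExtVanishesBelow R (pathComplex l) d := by
  classical
  induction d generalizing l with
  | zero => exact .zero _
  | succ d ih =>
    match l with
    | [] =>
      rw [List.length_nil] at hd
      omega
    | [a] =>
      obtain rfl : d = 0 := by
        rw [List.length_singleton] at hd
        omega
      have : starComplex a (pathComplex [a]) = pathComplex [a] := by
        refine le_antisymm starComplex_le fun F (hF : F ∈ _) => ?_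
        rw [SetLike.mem_coe, mem_pathComplex] at hF
        simpa [mem_starComplex, mem_pathComplex, NoTwoConsecutive] using hF
      rw [← this]
      exact .star (.zero _)
    | a :: b :: l =>
      rw [List.length_cons, List.length_cons] at hd
      have hd' : 3 * d ≤ l.tail.length + 2 := by
        rw [List.length_tail]
        omega
      rw [← starComplex_sup_starComplex_pathComplex (List.nodup_cons.1 hl).1]
      refine .sup (.star ?_) (.star ?_) ?_
      · rw [linkComplex_pathComplex_cons hl]
        exact ih _ hl.of_cons.of_cons (by rw [List.tail_cons]; omega)
      · rw [linkComplex_pathComplex_cons_cons hl]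
        exact ih _ hl.of_cons.of_cons.tail hd'
      · rw [starComplex_inf_starComplex_pathComplex hl]
        exact ih _ hl.of_cons.of_cons.tail hd'

theorem faceExtVanishesBelow_starComplex_cycleComplex [DecidableEq V] (h : (l ++ a :: m).Nodup)
    (hd : 3 * d ≤ l.length + m.length) :
    FaceExtVanishesBelow R (starComplex a (cycleComplex (l ++ a :: m : List V))) (d + 1) := by
  refine .star ?_
  rcases d.eq_zero_or_pos with rfl | hd₀
  · exact .zero _
  have hml : m ++ l ≠ [] := List.ne_nil_of_length_pos (by rw [List.length_append]; omega)
  rw [linkComplex_cycleComplex_append h hml]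
  refine faceExtVanishesBelow_pathComplex _ _ ?_ (by simp; omega)
  exact (List.nodup_append_comm.1 h).of_cons.tail.sublist (List.dropLast_sublist _)

theorem faceExtVanishesBelow_starComplex_inf_starComplex_cycleComplex [DecidableEq V]
    (h : (a :: u :: (l ++ [w])).Nodup) (hd : 3 * d ≤ l.length + 1) :
    FaceExtVanishesBelow R (starComplex u (cycleComplex (a :: u :: (l ++ [w]) : List V)) ⊓
      starComplex w (cycleComplex (a :: u :: (l ++ [w]) : List V))) d := by
  rcases d with _ | d
  · exact .zero _
  obtain ⟨x, l, rfl⟩ := List.exists_cons_of_length_pos (l := l) (by omega)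
  have huw : u ≠ w := by grind
  have hlw : (l ++ [w]).Nodup := by grind
  have hlink : linkComplex u (cycleComplex (a :: u :: (x :: l ++ [w]) : List V)) =
      pathComplex (l ++ [w]) := by
    simpa using linkComplex_cycleComplex_append (l := [a]) h (by simp)
  rw [starComplex_inf_starComplex_cycleComplex_of_ne_nil h (List.cons_ne_nil x l)]
  refine .star ?_
  rw [linkComplex_starComplex_comm huw.symm, hlink]
  refine (FaceExtVanishesBelow.star ?_).mono d.le_succ
  rw [linkComplex_pathComplex_concat hlw]
  refine faceExtVanishesBelow_pathComplex _ _
    (hlw.of_append_left.sublist (List.dropLast_sublist _)) ?_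
  rw [List.length_cons] at hd
  rw [List.length_dropLast]
  omega

theorem HasFaceDepth.cycleComplex_cons_cons_concat (h : (a :: u :: (l ++ [w])).Nodup)
    (hl : HasFaceDepth R (cycleComplex (l : Cycle V)) ((l.length + 1) / 3)) :
    HasFaceDepth R (cycleComplex ((a :: u :: (l ++ [w]) : List V) : Cycle V))
      ((l.length + 1) / 3 + 1) := by
  classical
  set d := (l.length + 1) / 3
  have ha : FaceExtVanishesBelow R (starComplex a _) (d + 1) :=
    faceExtVanishesBelow_starComplex_cycleComplex (l := []) h (by simp; omega)
  have hu : FaceExtVanishesBelow R (starComplex u _) (d + 1) :=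
    faceExtVanishesBelow_starComplex_cycleComplex (l := [a]) h (by simp; omega)
  have hw : FaceExtVanishesBelow R (starComplex w _) (d + 1) :=
    faceExtVanishesBelow_starComplex_cycleComplex (l := a :: u :: l) h (by simp; omega)
  have huw := faceExtVanishesBelow_starComplex_inf_starComplex_cycleComplex (R := R) (d := d) h
    (by omega)
  rw [← starComplex_sup_starComplex_sup_starComplex_cycleComplex (List.nodup_cons.1 h).1]
  refine .sup ha (hu.sup hw huw) ?_
  rwa [starComplex_inf_sup_cycleComplex h]

theorem hasFaceDepth_cycleComplex [Nontrivial R] (l : List V) (hl : l.Nodup) :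
    HasFaceDepth R (cycleComplex (l : Cycle V)) ((l.length + 1) / 3) := by
  match l with
  | [] | [a] =>
    rw [cycleComplex_coe hl]
    simpa [pathComplex_nil] using hasFaceDepth_Iic_empty
  | [a, b] =>
    have hab : pathComplex [b] ⊓ pathComplex [a] = LowerSet.Iic ∅ := by
      refine SetLike.ext fun F => ?_
      grind [LowerSet.mem_inf_iff, mem_pathComplex, NoTwoConsecutive, LowerSet.mem_Iic_iff]
    suffices HasFaceDepth R (pathComplex [b] ⊔ pathComplex [a]) (0 + 1) by
      simpa [cycleComplex_coe hl] using this
    refine .sup (faceExtVanishesBelow_pathComplex (R := R) 1 [b] (by simp) (by simp))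
      (faceExtVanishesBelow_pathComplex 1 [a] (by simp) (by simp)) ?_
    simpa [hab] using hasFaceDepth_Iic_empty (R := R)
  | a :: u :: v :: m =>
    obtain ⟨l, w, hlw⟩ := List.eq_nil_or_concat' (v :: m) |>.resolve_left (by simp)
    have hlen : m.length = l.length := by simpa using congrArg List.length hlw
    rw [hlw] at hl ⊢
    have hdepth : HasFaceDepth R (cycleComplex (l : Cycle V)) _ :=
      hasFaceDepth_cycleComplex l hl.of_cons.of_cons.of_append_left
    convert hdepth.cycleComplex_cons_cons_concat hl using 1
    simp only [List.length_cons, List.length_append, List.length_nil]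
    omega
termination_by l.length

end PathsAndCycles

section PrimeDecomposition

variable {R M : Type*} [CommRing R] [AddCommGroup M] [Module R M]

theorem associatedPrimes_quotient (N : Submodule R M) :
    associatedPrimes R (M ⧸ N) = N.associatedPrimes := by
  have hcolon (x : M) :
      (⊥ : Submodule R (M ⧸ N)).colon {Submodule.Quotient.mk x} = N.colon {x} := by
    ext r
    rw [Submodule.mem_colon_singleton, Submodule.mem_colon_singleton, Submodule.mem_bot,
      ← Submodule.Quotient.mk_smul, Submodule.Quotient.mk_eq_zero]
  ext p
  change Submodule.IsAssociatedPrime ⊥ p ↔ Submodule.IsAssociatedPrime N p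
  rw [Submodule.isAssociatedPrime_def, Submodule.isAssociatedPrime_def,
    (Submodule.Quotient.mk_surjective N).exists]
  simp only [hcolon]

variable {s : Set (Ideal R)}

theorem minimalPrimes_sInf (hs : s.Finite) (hprime : ∀ p ∈ s, p.IsPrime)
    (hanti : IsAntichain (· ≤ ·) s) : (sInf s).minimalPrimes = s := by
  have exists_le {q : Ideal R} (hq : q.IsPrime) (hle : sInf s ≤ q) : ∃ p ∈ s, p ≤ q := by
    lift s to Finset (Ideal R) using hs
    rw [← s.inf_id_eq_sInf] at hle
    exact hq.inf_le'.1 hle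
  ext p
  refine ⟨fun hp => ?_, fun hp => ⟨⟨hprime p hp, sInf_le hp⟩, fun q hq hqp => ?_⟩⟩
  · obtain ⟨q, hq, hqp⟩ := exists_le hp.1.1 hp.1.2
    rwa [← hqp.antisymm (hp.2 ⟨hprime q hq, sInf_le hq⟩ hqp)]
  · obtain ⟨p', hp', hp'q⟩ := exists_le hq.1 hq.2
    rwa [← hanti.eq hp' hp (hp'q.trans hqp)]

theorem associatedPrimes_quotient_sInf (hs : s.Finite) (hprime : ∀ p ∈ s, p.IsPrime)
    (hanti : IsAntichain (· ≤ ·) s) : associatedPrimes R (R ⧸ sInf s) = s := by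
  classical
  lift s to Finset (Ideal R) using hs
  have hradical {p : Ideal R} (hp : p ∈ s) : (p.colon Set.univ).radical = p := by
    rw [Submodule.colon_univ, (hprime p hp).radical]
  have hdecomposition : Submodule.IsMinimalPrimaryDecomposition (s.inf id) s :=
    { inf_eq := rfl
      primary := fun p hp => (hprime p hp).isPrimary
      distinct := fun p hp q hq hpq h => hpq (by rwa [← hradical hp, ← hradical hq])
      minimal := fun p hp hle => by
        obtain ⟨q, hq, hqp⟩ := (hprime p hp).inf_le'.1 hle
        obtain ⟨hne, hq⟩ := Finset.mem_erase.1 hq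
        exact hne (hanti.eq hq hp hqp) }
  rw [associatedPrimes_quotient, ← s.inf_id_eq_sInf,
    ← hdecomposition.image_radical_eq_associated_primes]
  exact (Set.image_congr fun _ => hradical).trans (Set.image_id _)

end PrimeDecomposition

section FacePrimes

open MvPolynomial

section VariableIdeals

universe u v

variable {R : Type u} [CommRing R] {V : Type v}

theorem ker_killCompl_notMem (T : Set V) :
    RingHom.ker (killCompl (R := R) (Subtype.val_injective (p := (· ∉ T)))) =
      Ideal.span (X '' T) := by
  ext f
  rw [RingHom.mem_ker, mem_ideal_span_X_image, ← support_eq_empty, support_killCompl,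
    Finset.eq_empty_iff_forall_notMem]
  constructor
  · intro h m hm
    by_contra! hmT
    refine h (m.comapDomain Subtype.val Subtype.val_injective.injOn) ?_
    rw [Finset.mem_preimage, Finsupp.mapDomain_comapDomain _ Subtype.val_injective]
    · exact hm
    · intro i hi
      exact ⟨⟨i, fun hiT => Finsupp.mem_support_iff.1 hi (hmT i hiT)⟩, rfl⟩
  · intro h s hs
    obtain ⟨i, hiT, hi⟩ := h _ (Finset.mem_preimage.1 hs)
    exact hi (Finsupp.mapDomain_of_notMem_range _ _ (by simpa using hiT))

theorem killCompl_surjective {σ τ S : Type*} [CommSemiring S] {f : σ → τ}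
    (hf : Function.Injective f) : Function.Surjective (killCompl (R := S) hf) :=
  fun p => ⟨rename f p, killCompl_rename_app hf p⟩

theorem isPrime_span_X_image [IsDomain R] (T : Set V) :
    (Ideal.span (X '' T : Set (MvPolynomial V R))).IsPrime := by
  rw [← ker_killCompl_notMem]
  exact RingHom.ker_isPrime _

theorem ringKrullDim_quotient_span_X_image [IsNoetherianRing R] [Finite V] (T : Set V) :
    ringKrullDim (MvPolynomial V R ⧸ Ideal.span (X '' T : Set (MvPolynomial V R))) =
      ringKrullDim R + Nat.card ↥Tᶜ := by
  let φ := killCompl (R := R) (Subtype.val_injective (p := (· ∉ T)))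
  have e : (MvPolynomial V R ⧸ RingHom.ker φ) ≃+* MvPolynomial {i // i ∉ T} R :=
    RingHom.quotientKerEquivOfSurjective (f := φ.toRingHom) (killCompl_surjective _)
  rw [← ker_killCompl_notMem, ringKrullDim_eq_of_ringEquiv e, ringKrullDim_of_isNoetherianRing]
  rfl

theorem span_X_image_le_span_X_image [Nontrivial R] {S T : Set V} :
    Ideal.span (X '' S : Set (MvPolynomial V R)) ≤ Ideal.span (X '' T) ↔ S ⊆ T := by
  refine ⟨fun h i hi => ?_, fun h => Ideal.span_mono (Set.image_mono h)⟩
  obtain ⟨j, hj, hij⟩ := mem_ideal_span_X_image.1 (h (Ideal.subset_span ⟨i, hi, rfl⟩))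
    (Finsupp.single i 1) (by classical simp [X, support_monomial])
  rwa [← (Finsupp.single_apply_ne_zero.1 hij).1]

theorem height_span_X_image [IsDomain R] [IsNoetherianRing R] [Finite V] (T : Finset V) :
    (Ideal.span (X '' (T : Set V) : Set (MvPolynomial V R))).height = T.card := by
  classical
  have hprime (T : Set V) := isPrime_span_X_image (R := R) T
  refine le_antisymm ?_ ?_
  · refine (Ideal.height_le_card_of_mem_minimalPrimes_span (T.finite_toSet.image X) ?_).trans ?_
    · rw [Ideal.minimalPrimes_eq_subsingleton_self]
      rfl
    · rw [Nat.cast_le, ← Set.ncard_coe_finset T]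
      exact Set.ncard_image_le T.finite_toSet
  · induction T using Finset.induction with
    | empty => simp
    | insert i T hi ih =>
      have hlt : Ideal.span (X '' (T : Set V) : Set (MvPolynomial V R)) <
          Ideal.span (X '' (insert i T : Finset V)) :=
        lt_of_le_not_ge (span_X_image_le_span_X_image.2 (by simp))
          fun h => hi (span_X_image_le_span_X_image.1 h (by simp))
      rw [Finset.card_insert_of_notMem hi, Nat.cast_succ]
      exact (add_le_add_left ih 1).trans (Ideal.height_add_one_le_of_lt_of_isPrime hlt)

end VariableIdeals

universe u v

variable (R : Type u) [CommRing R] {V : Type v} {Δ : LowerSet (Finset V)} {W U : Finset V}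

/-- The ideal `P_W` generated by the variables outside the face `W`. -/
noncomputable def facePrime (W : Finset V) : Ideal (MvPolynomial V R) :=
  Ideal.span (X '' (W : Set V)ᶜ)

/-- The facets of a simplicial complex, that is, its maximal faces. -/
def facets (Δ : LowerSet (Finset V)) : Set (Finset V) :=
  {W | Maximal (· ∈ Δ) W}

variable {R}

theorem mem_facePrime {f : MvPolynomial V R} :
    f ∈ facePrime R W ↔ ∀ m ∈ f.support, ¬ m.support ⊆ W := by
  rw [facePrime, mem_ideal_span_X_image]
  simp only [Finset.not_subset, Finsupp.mem_support_iff, Set.mem_compl_iff, Finset.mem_coe]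
  grind

theorem facePrime_le_facePrime [Nontrivial R] : facePrime R W ≤ facePrime R U ↔ U ⊆ W := by
  rw [facePrime, facePrime, span_X_image_le_span_X_image, Set.compl_subset_compl,
    Finset.coe_subset]

theorem ringKrullDim_quotient_facePrime [IsNoetherianRing R] [Finite V] (W : Finset V) :
    ringKrullDim (MvPolynomial V R ⧸ facePrime R W) = ringKrullDim R + W.card := by
  rw [facePrime, ringKrullDim_quotient_span_X_image, compl_compl, Nat.card_coe_set_eq,
    Set.ncard_coe_finset]

theorem height_facePrime [IsDomain R] [IsNoetherianRing R] [Fintype V] (W : Finset V) :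
    (facePrime R W).height = (Fintype.card V - W.card : ℕ) := by
  classical
  rw [facePrime, ← Finset.coe_compl, height_span_X_image, Finset.card_compl]

theorem stanleyReisnerIdeal_eq_sInf_facePrime [Finite V] (Δ : LowerSet (Finset V)) :
    stanleyReisnerIdeal R Δ = sInf (facePrime R '' facets Δ) := by
  ext f
  simp only [mem_stanleyReisnerIdeal, Submodule.mem_sInf, Set.forall_mem_image, mem_facePrime]
  refine ⟨fun h W hW m hm hmW => h m hm (Δ.lower hmW hW.prop), fun h m hm hmΔ => ?_⟩
  obtain ⟨W, hmW, hW⟩ := (Set.toFinite {F | F ∈ Δ}).exists_le_maximal hmΔ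
  exact h hW m hm hmW

section Decomposition

theorem isPrime_of_mem_facePrime_image [IsDomain R] {s : Set (Finset V)}
    {p : Ideal (MvPolynomial V R)} (hp : p ∈ facePrime R '' s) : p.IsPrime := by
  obtain ⟨W, -, rfl⟩ := hp
  exact isPrime_span_X_image _

theorem isAntichain_facePrime_facets [Nontrivial R] :
    IsAntichain (· ≤ ·) (facePrime R '' facets Δ) := by
  rintro _ ⟨W, hW, rfl⟩ _ ⟨U, hU, rfl⟩ hne hle
  exact hne (congrArg _ ((facePrime_le_facePrime.1 hle).antisymm
    (hU.le_of_ge hW.prop (facePrime_le_facePrime.1 hle))).symm)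

variable [IsDomain R] [Finite V]

theorem minimalPrimes_stanleyReisnerIdeal (Δ : LowerSet (Finset V)) :
    (stanleyReisnerIdeal R Δ).minimalPrimes = facePrime R '' facets Δ := by
  rw [stanleyReisnerIdeal_eq_sInf_facePrime]
  exact minimalPrimes_sInf (Set.toFinite _) (fun _ => isPrime_of_mem_facePrime_image)
    isAntichain_facePrime_facets

theorem associatedPrimes_quotient_stanleyReisnerIdeal (Δ : LowerSet (Finset V)) :
    associatedPrimes (MvPolynomial V R) (MvPolynomial V R ⧸ stanleyReisnerIdeal R Δ) =
      facePrime R '' facets Δ := by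
  rw [stanleyReisnerIdeal_eq_sInf_facePrime]
  exact associatedPrimes_quotient_sInf (Set.toFinite _) (fun _ => isPrime_of_mem_facePrime_image)
    isAntichain_facePrime_facets

end Decomposition

variable [IsDomain R] [IsNoetherianRing R] {k : ℕ}

theorem moduleMdepth_stanleyReisner [Finite V] (hk : IsLeast (Finset.card '' facets Δ) k) :
    moduleMdepth (MvPolynomial V R) (MvPolynomial V R ⧸ stanleyReisnerIdeal R Δ) =
      ringKrullDim R + k := by
  rw [moduleMdepth, associatedPrimes_quotient_stanleyReisnerIdeal, iInf_image]
  simp only [ringKrullDim_quotient_facePrime]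
  obtain ⟨⟨W, hW, rfl⟩, hmin⟩ := hk
  refine le_antisymm (iInf₂_le W hW) (le_iInf₂ fun U hU => ?_)
  exact add_le_add_right (mod_cast hmin ⟨U, hU, rfl⟩) _

theorem bigHeight_stanleyReisnerIdeal [Fintype V] (hk : IsLeast (Finset.card '' facets Δ) k) :
    bigHeight (stanleyReisnerIdeal R Δ) = (Fintype.card V - k : ℕ) := by
  rw [bigHeight, minimalPrimes_stanleyReisnerIdeal, iSup_image]
  simp only [height_facePrime]
  obtain ⟨⟨W, hW, rfl⟩, hmin⟩ := hk
  refine le_antisymm (iSup₂_le fun U hU => ?_)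
    (le_iSup₂ (f := fun (W : Finset V) _ => ((Fintype.card V - W.card : ℕ) : ℕ∞)) W hW)
  exact Nat.cast_le.2 (Nat.sub_le_sub_left (hmin ⟨U, hU, rfl⟩) _)

end FacePrimes

section EdgeIdeals

open MvPolynomial

universe u v

variable {V : Type v} {G : SimpleGraph V} {W : Finset V}

/-- The independence complex of a graph, whose faces are the independent sets. -/
def indepComplex (G : SimpleGraph V) : LowerSet (Finset V) where
  carrier := {F | G.IsIndepSet F}
  lower' _ _ hGF hF := hF.mono (Finset.coe_subset.2 hGF)

theorem mem_indepComplex : W ∈ indepComplex G ↔ ∀ i ∈ W, ∀ j ∈ W, ¬ G.Adj i j :=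
  ⟨fun h _ hi _ hj hij => h hi hj hij.ne hij, fun h i hi j hj _ => h i hi j hj⟩

theorem edgeIdeal_eq_stanleyReisnerIdeal (K : Type u) [Field K] (G : SimpleGraph V) :
    edgeIdeal K G = stanleyReisnerIdeal K (indepComplex G) := by
  classical
  have hX (i j : V) : (X i * X j : MvPolynomial V K) =
      monomial (Finsupp.single i 1 + Finsupp.single j 1) 1 := by
    rw [X, X, monomial_mul, one_mul]
  refine le_antisymm (Ideal.span_le.2 ?_) (stanleyReisnerIdeal_le.2 fun m hm => ?_)
  · rintro _ ⟨i, j, hij, rfl⟩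
    rw [hX]
    exact monomial_mem_stanleyReisnerIdeal fun h =>
      mem_indepComplex.1 h i (by simp) j (by simp) hij
  · rw [mem_indepComplex] at hm
    push Not at hm
    obtain ⟨i, hi, j, hj, hij⟩ := hm
    have hmem : (X i * X j : MvPolynomial V K) ∈ edgeIdeal K G :=
      Ideal.subset_span ⟨i, j, hij, rfl⟩
    refine Ideal.mem_of_dvd _ ?_ hmem
    rw [hX, monomial_dvd_monomial]
    refine ⟨Or.inr fun k => ?_, dvd_rfl⟩
    rw [Finsupp.mem_support_iff] at hi hj
    have hne := hij.ne
    simp only [Finsupp.add_apply, Finsupp.single_apply]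
    grind

theorem mem_facets_indepComplex : W ∈ facets (indepComplex G) ↔
    W ∈ indepComplex G ∧ ∀ v ∉ W, ∃ w ∈ W, G.Adj v w := by
  classical
  refine ⟨fun hW => ⟨hW.prop, fun v hv => ?_⟩, fun ⟨hW, hdom⟩ => ⟨hW, fun U hU hWU v hv => ?_⟩⟩
  · by_contra! h
    refine hv (hW.le_of_ge ?_ (Finset.subset_insert v W) (Finset.mem_insert_self v W))
    have hind := mem_indepComplex.1 hW.prop
    simp only [mem_indepComplex, Finset.forall_mem_insert, G.irrefl, not_false_eq_true, true_and]
    exact ⟨h, fun i hi => ⟨fun hiv => h i hi hiv.symm, hind i hi⟩⟩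
  · by_contra hvW
    obtain ⟨w, hw, hvw⟩ := hdom v hvW
    exact mem_indepComplex.1 hU v hv w (hWU hw) hvw

theorem card_le_mul_card_of_mem_facets_indepComplex [Fintype V] [DecidableRel G.Adj] {d : ℕ}
    (hd : ∀ v, G.degree v ≤ d) (hW : W ∈ facets (indepComplex G)) :
    Fintype.card V ≤ W.card * (d + 1) := by
  classical
  have hcover : Finset.univ ⊆ W.biUnion fun w => insert w (G.neighborFinset w) := by
    intro v _
    rw [Finset.mem_biUnion]
    by_cases hv : v ∈ W
    · exact ⟨v, hv, Finset.mem_insert_self _ _⟩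
    · obtain ⟨w, hw, hvw⟩ := (mem_facets_indepComplex.1 hW).2 v hv
      exact ⟨w, hw, Finset.mem_insert_of_mem ((G.mem_neighborFinset w v).2 hvw.symm)⟩
  refine (Finset.card_le_card hcover).trans (Finset.card_biUnion_le_card_mul _ _ _ fun w _ => ?_)
  exact (Finset.card_insert_le _ _).trans (Nat.succ_le_succ (hd w))

end EdgeIdeals

section CycleGraph

open SimpleGraph

variable {n : ℕ}

theorem chain_finRange_succ (r : Fin (n + 1) → Fin (n + 1) → Prop) :
    Cycle.Chain r (List.finRange (n + 1)) ↔ ∀ i, r i (i + 1) := by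
  have h := Cycle.chain_map (r := fun a b => r (Fin.ofNat _ a) (Fin.ofNat _ b)) Fin.val
    (s := (List.finRange (n + 1) : Cycle (Fin (n + 1))))
  simp only [Fin.ofNat_val_eq_self, Cycle.map_coe, List.map_coe_finRange_eq_range] at h
  rw [← h, Cycle.chain_range_succ, Fin.forall_fin_succ', and_comm]
  refine and_congr ?_ ?_
  · simp only [Fin.forall_iff, Fin.coeSucc_eq_succ]
    refine forall₂_congr fun i hi => iff_of_eq (congrArg₂ r (Fin.ext ?_) (Fin.ext ?_))
    · exact Nat.mod_eq_of_lt (hi.trans n.lt_succ_self)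
    · exact Nat.mod_eq_of_lt (Nat.succ_lt_succ hi)
  · simp

theorem indepComplex_cycleGraph (hn : 2 ≤ n) :
    indepComplex (cycleGraph n) = cycleComplex (List.finRange n : Cycle (Fin n)) := by
  obtain ⟨n, rfl⟩ := Nat.exists_eq_add_of_le' hn
  ext F
  change F ∈ indepComplex _ ↔ (∀ i ∈ F, i ∈ List.finRange _) ∧ Cycle.Chain _ _
  rw [chain_finRange_succ, mem_indepComplex]
  simp only [cycleGraph_adj, List.mem_finRange, implies_true, true_and, not_and]
  refine ⟨fun h i hi hi' => h i hi _ hi' (Or.inr (by simp)), fun h i hi j hj => ?_⟩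
  rintro (hij | hij)
  · exact h j hj (by rwa [← hij, add_sub_cancel])
  · exact h i hi (by rwa [← hij, add_sub_cancel])

theorem cycleGraph_adj_iff_val (hn : 3 ≤ n) {u v : Fin n} :
    (cycleGraph n).Adj u v ↔ (u : ℕ) + 1 = v ∨ (v : ℕ) + 1 = u ∨
      ((u : ℕ) = 0 ∧ (v : ℕ) + 1 = n) ∨ ((v : ℕ) = 0 ∧ (u : ℕ) + 1 = n) := by
  rw [cycleGraph_adj']
  rcases le_or_gt u v with h | h
  · rcases h.eq_or_lt with rfl | h'
    · rw [Fin.coe_sub_iff_le.2 le_rfl]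
      omega
    · rw [Fin.coe_sub_iff_lt.2 h', Fin.coe_sub_iff_le.2 h]
      omega
  · rw [Fin.coe_sub_iff_lt.2 h, Fin.coe_sub_iff_le.2 h.le]
    omega

theorem exists_mem_facets_card_eq (hn : 3 ≤ n) :
    ∃ W ∈ facets (indepComplex (cycleGraph n)), W.card = (n + 2) / 3 := by
  -- The bound `n - 2` only affects a last vertex `n - 1`, which would be adjacent to `0`.
  let vertex (k : Fin ((n + 2) / 3)) : Fin n := ⟨min (3 * k) (n - 2), by omega⟩
  have hinj : Function.Injective vertex := fun k l hkl => by
    have := congrArg Fin.val hkl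
    simp only [vertex] at this
    omega
  refine ⟨Finset.univ.image vertex, mem_facets_indepComplex.2 ⟨?_, fun v hv => ?_⟩, ?_⟩
  · simp only [mem_indepComplex, Finset.forall_mem_image, cycleGraph_adj_iff_val hn, vertex]
    intro k _ l _
    omega
  · simp only [Finset.mem_image, Finset.mem_univ, true_and, not_exists] at hv
    simp only [Finset.exists_mem_image, Finset.mem_univ, true_and, cycleGraph_adj_iff_val hn]
    by_cases hk : ((v : ℕ) + 1) / 3 < (n + 2) / 3
    · refine ⟨⟨(v + 1) / 3, hk⟩, ?_⟩
      have := Fin.val_ne_of_ne (hv ⟨(v + 1) / 3, hk⟩)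
      simp only [vertex] at this ⊢
      omega
    · refine ⟨⟨0, by omega⟩, ?_⟩
      simp only [vertex]
      omega
  · rw [Finset.card_image_of_injective _ hinj, Finset.card_univ, Fintype.card_fin]

theorem moduleDepth_stanleyReisner_indepComplex_cycleGraph {R : Type*} [CommRing R]
    [IsNoetherianRing R] [Nontrivial R] (hn : 2 ≤ n) :
    moduleDepth (MvPolynomial.idealOfVars (Fin n) R)
      (MvPolynomial (Fin n) R ⧸ stanleyReisnerIdeal R (indepComplex (cycleGraph n))) =
        ((n + 1) / 3 : ℕ) := by
  refine moduleDepth_stanleyReisner (mem_indepComplex.2 (by simp)) ?_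
  rw [indepComplex_cycleGraph hn]
  simpa using hasFaceDepth_cycleComplex _ (List.nodup_finRange n)

theorem isLeast_card_facets_indepComplex_cycleGraph (hn : 3 ≤ n) :
    IsLeast (Finset.card '' facets (indepComplex (cycleGraph n))) ((n + 2) / 3) := by
  refine ⟨exists_mem_facets_card_eq hn, ?_⟩
  rintro _ ⟨W, hW, rfl⟩
  obtain ⟨k, rfl⟩ := Nat.exists_eq_add_of_le' hn
  have h := card_le_mul_card_of_mem_facets_indepComplex (d := 2)
    (fun v => cycleGraph_degree_three_le.le) hW
  rw [Fintype.card_fin] at h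
  omega

end CycleGraph

theorem mainTheorem1 (K : Type*) [Field K] (n : ℕ) (hn : 3 ≤ n) :
    (HasMaximalDepth (MvPolynomial.idealOfVars (Fin n) K)
        (MvPolynomial (Fin n) K ⧸ edgeIdeal K (SimpleGraph.cycleGraph n)) ↔
      n ≡ 0 [MOD 3] ∨ n ≡ 2 [MOD 3]) ∧
    (moduleDepth (MvPolynomial.idealOfVars (Fin n) K)
        (MvPolynomial (Fin n) K ⧸ edgeIdeal K (SimpleGraph.cycleGraph n)) +
        bigHeight (edgeIdeal K (SimpleGraph.cycleGraph n)) = n ↔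
      n ≡ 0 [MOD 3] ∨ n ≡ 2 [MOD 3]) := by
  have hfacets := isLeast_card_facets_indepComplex_cycleGraph hn
  rw [HasMaximalDepth, edgeIdeal_eq_stanleyReisnerIdeal,
    moduleDepth_stanleyReisner_indepComplex_cycleGraph (by omega),
    moduleMdepth_stanleyReisner hfacets, ringKrullDim_eq_zero_of_field, zero_add,
    bigHeight_stanleyReisnerIdeal hfacets, Fintype.card_fin]
  norm_cast
  grind [Nat.ModEq]
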